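/- Let $k\ge 1$ be an integer. All graphs are finite, may have parallel edges and loops, and have no isolated vertices. For a graph $G$ and $C\subseteq E(G)$ let $G\langle C\rangle$ be the subgraph formed by the edges of $C$ and their end vertices. Let $M_k(G)$ be the matroid on $E(G)$ whose circuits are the sets $C\subseteq E(G)$ such that $|C|-|V(G\langle C\rangle)|=k$ and $G\langle C\rangle$ has no isolated vertices, no leaves (vertices of degree one) and no component that is a cycle (a loop, or a pair of parallel edges, also counts as a cycle). A matroid is called connected if it has no loops, no coloops, and every two elements belong to a common circuit. A non-separating cocircuit of a connected matroid $M$ is a cocircuit $K$ such that $M\setminus K$ is connected. For a vertex $v$ of $G$ let $S(v,G)$ be its star, i.e. the set of edges of $G$ incident to $v$, and let $\mathcal S(G)=\{S(v,G):v\in V(G)\}$. Graphs $G$ and $G'$ with $E(G)=E(G')$ are strongly isomorphic if there is a bijection $\nu:V(G)\to V(G')$ such that, for every edge $e$ and all vertices $x,y$ of $G$, $e$ has ends $x,y$ in $G$ if and only if $e$ has ends $\nu(x),\nu(y)$ in $G'$. **Theorem.** Let $G$ and $G'$ be graphs and $k\ge 1$. Suppose that - $G$ and $G'$ have no loops, -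 $M_k(G)$ is a connected matroid, - $G$ has exactly one vertex $v$ such that $S(v,G)$ is not a non-separating cocircuit of $M_k(G)$, and - $M_k(G')=M_k(G)$. Then $\mathcal S(G)=\mathcal S(G')$; that is, $G$ and $G'$ are strongly isomorphic. -/

import Mathlib

open Graph

namespace KCircular

/-- The degree of a vertex; a loop contributes `2`. -/
noncomputable def degree {α β : Type*} (G : Graph α β) (x : α) : ℕ :=
  {e | G.IsNonloopAt e x}.ncard + 2 * {e | G.IsLoopAt e x}.ncard

/-- The subgraph `G⟨X⟩` induced by a set `X` of edges: its edges are the edges of `G` in `X`, its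
vertices are the ends of these edges. -/
def edgeInduced {α β : Type*} (G : Graph α β) (X : Set β) : Graph α β where
  vertexSet := {x | ∃ e ∈ X, G.Inc e x}
  IsLink e x y := e ∈ X ∧ G.IsLink e x y
  edgeSet := {e | e ∈ X ∧ e ∈ E(G)}
  isLink_symm _ _ := ⟨fun _ _ h => ⟨h.1, h.2.symm⟩⟩
  eq_or_eq_of_isLink_of_isLink _ _ _ _ _ h h' := h.2.left_eq_or_eq h'.2
  edge_mem_iff_exists_isLink e := by
    constructor
    · rintro ⟨h, he⟩
      obtain ⟨x, y, hxy⟩ := exists_isLink_of_mem_edgeSet he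
      exact ⟨x, y, h, hxy⟩
    · rintro ⟨x, y, h, hxy⟩
      exact ⟨h, hxy.edge_mem⟩
  left_mem_of_isLink e x y h := ⟨e, h.1, y, h.2⟩

/-- `Δ H = |E(H)| - |V(H)|` for a finite graph `H`. -/
noncomputable def delta {α β : Type*} (H : Graph α β) : ℤ := (E(H).ncard : ℤ) - V(H).ncard

/-- The vertex set of the connected component of `H` containing `x`. -/
def componentVerts {α β : Type*} (H : Graph α β) (x : α) : Set α :=
  {y | Relation.ReflTransGen H.Adj x y}

/-- The connected component of `H` containing the vertex `x` is a cycle (a loop and a pair of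
parallel edges count as cycles of length `1` and `2`), i.e. that component is `2`-regular. -/
def IsCycleComponentAt {α β : Type*} (H : Graph α β) (x : α) : Prop :=
  ∀ y ∈ componentVerts H x, degree H y = 2

/-- A cacti-graph: no isolated vertices, no leaves and no cycle components. -/
structure IsCactiGraph {α β : Type*} (H : Graph α β) : Prop where
  no_isolated : ∀ x ∈ V(H), (H.incidenceSet x).Nonempty
  no_leaf : ∀ x ∈ V(H), degree H x ≠ 1
  no_cycle_component : ∀ x ∈ V(H), ¬ IsCycleComponentAt H x

/-- The family `𝒞ₖ(G)` of `k`-circuits of `G`. -/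
def kCircuits {α β : Type*} (G : Graph α β) (k : ℕ) : Set (Set β) :=
  {C | C ⊆ E(G) ∧ delta (edgeInduced G C) = k ∧ IsCactiGraph (edgeInduced G C)}

/-- A set of edges containing no `k`-circuit. -/
def KIndep {α β : Type*} (G : Graph α β) (k : ℕ) (X : Set β) : Prop :=
  X ⊆ E(G) ∧ ∀ C ∈ kCircuits G k, ¬ C ⊆ X

section aux

variable {α β : Type*} {G : Graph α β} {k : ℕ} {X Y C : Set β}

lemma finite_ends (hX : X.Finite) : {x | ∃ e ∈ X, G.Inc e x}.Finite := by
  have : {x | ∃ e ∈ X, G.Inc e x} = ⋃ e ∈ X, {x | G.Inc e x} := by ext; simp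
  rw [this]
  refine hX.biUnion fun e _ => ?_
  by_cases he : e ∈ E(G)
  · obtain ⟨a, b, hab⟩ := exists_isLink_of_mem_edgeSet he
    exact (Set.toFinite {a, b}).subset fun x hx => hx.eq_or_eq_of_isLink hab
  · convert Set.finite_empty
    ext x
    simp [G.not_inc_of_notMem_edgeSet he]

lemma edgeSet_edgeInduced (hX : X ⊆ E(G)) : E(edgeInduced G X) = X :=
  Set.ext fun _ => ⟨fun h => h.1, fun h => ⟨h, hX h⟩⟩

lemma delta_eq_iff (hC : C ⊆ E(G)) : delta (edgeInduced G C) = k ↔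
    C.ncard = V(edgeInduced G C).ncard + k := by
  rw [delta, edgeSet_edgeInduced hC]
  omega

open Classical in
lemma mult_eq {H : Graph α β} {e : β} {a b x : α} (h : H.IsLink e a b) :
    (if H.IsNonloopAt e x then 1 else 0) + 2 * (if H.IsLoopAt e x then 1 else 0) =
      (if a = x then 1 else 0) + (if b = x then 1 else 0) := by
  have h1 : H.IsLoopAt e x ↔ a = x ∧ b = x := by
    rw [IsLoopAt, h.isLink_iff]
    tauto
  have h2 : H.IsNonloopAt e x ↔ (a = x ∧ b ≠ x) ∨ (b = x ∧ a ≠ x) := by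
    constructor
    · rintro ⟨y, hy, hl⟩
      rw [h.isLink_iff] at hl
      rcases hl with ⟨rfl, rfl⟩ | ⟨rfl, rfl⟩
      · exact Or.inl ⟨rfl, hy⟩
      · exact Or.inr ⟨rfl, hy⟩
    · rintro (⟨rfl, hb⟩ | ⟨rfl, ha⟩)
      · exact ⟨b, hb, h⟩
      · exact ⟨a, ha, h.symm⟩
  by_cases ha : a = x <;> by_cases hb : b = x <;> simp [h1, h2, ha, hb]

open Classical in
lemma degree_eq_sum {H : Graph α β} (F : Finset β) (x : α) (hF : ∀ e, H.Inc e x → e ∈ F) :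
    degree H x = ∑ e ∈ F, ((if H.IsNonloopAt e x then 1 else 0) +
      2 * (if H.IsLoopAt e x then 1 else 0)) := by
  have h1 : {e | H.IsNonloopAt e x} = ↑(F.filter fun e => H.IsNonloopAt e x) := by
    ext e
    simpa using fun h => hF e h.inc
  have h2 : {e | H.IsLoopAt e x} = ↑(F.filter fun e => H.IsLoopAt e x) := by
    ext e
    simpa using fun h => hF e h.inc
  rw [degree, h1, h2, Set.ncard_coe_finset, Set.ncard_coe_finset, Finset.sum_add_distrib,
    ← Finset.mul_sum, Finset.card_filter, Finset.card_filter]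

open Classical in
lemma sum_degree_eq {H : Graph α β} (F : Finset β) (W : Finset α)
    (hF : ∀ x ∈ W, ∀ e, H.Inc e x → e ∈ F) :
    ∑ x ∈ W, degree H x = ∑ e ∈ F, ∑ x ∈ W, ((if H.IsNonloopAt e x then 1 else 0) +
      2 * (if H.IsLoopAt e x then 1 else 0)) := by
  rw [Finset.sum_comm]
  exact Finset.sum_congr rfl fun x hx => degree_eq_sum F x (hF x hx)

open Classical in
lemma sum_mult_eq {H : Graph α β} {e : β} {a b : α} (W : Finset α) (h : H.IsLink e a b) :
    ∑ x ∈ W, ((if H.IsNonloopAt e x then 1 else 0) + 2 * (if H.IsLoopAt e x then 1 else 0)) =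
      (if a ∈ W then 1 else 0) + (if b ∈ W then 1 else 0) := by
  rw [Finset.sum_congr rfl fun x _ => mult_eq h, Finset.sum_add_distrib, Finset.sum_ite_eq,
    Finset.sum_ite_eq]

/-- A nonempty-or-empty finite edge set `Y` with `Δ ≥ k` contains a `k`-circuit. -/
lemma exists_kCircuit (hk : 1 ≤ k) (hY : Y.Finite) (hYE : Y ⊆ E(G))
    (h : V(edgeInduced G Y).ncard + k ≤ Y.ncard) : ∃ C ∈ kCircuits G k, C ⊆ Y := by
  classical
  induction hn : Y.ncard using Nat.strong_induction_on generalizing Y with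
  | _ n ih =>
  subst hn
  -- a proper subset that still has `Δ ≥ k` finishes the proof
  have step : ∀ Z ⊂ Y, V(edgeInduced G Z).ncard + k ≤ Z.ncard → ∃ C ∈ kCircuits G k, C ⊆ Y := by
    intro Z hZ hZk
    obtain ⟨C, hC, hCZ⟩ := ih _ (Set.ncard_lt_ncard hZ hY) (hY.subset hZ.subset)
      (hZ.subset.trans hYE) hZk rfl
    exact ⟨C, hC, hCZ.trans hZ.subset⟩
  by_contra hcon
  have hmin : ∀ Z ⊂ Y, Z.ncard < V(edgeInduced G Z).ncard + k := fun Z hZ => by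
    by_contra hlt
    exact hcon (step Z hZ (not_lt.1 hlt))
  apply hcon
  have hVfin : V(edgeInduced G Y).Finite := finite_ends hY
  have hmono : ∀ Z ⊆ Y, V(edgeInduced G Z) ⊆ V(edgeInduced G Y) :=
    fun Z hZ x ⟨e, he, hx⟩ => ⟨e, hZ he, hx⟩
  refine ⟨Y, ⟨hYE, (delta_eq_iff hYE).2 ?_, ⟨?_, ?_, ?_⟩⟩, subset_rfl⟩
  · have hne : Y.Nonempty := by
      rw [Set.nonempty_iff_ne_empty]
      rintro rfl
      simp at h
      omega
    obtain ⟨e, he⟩ := hne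
    have h1 := hmin (Y \ {e}) (Set.sdiff_singleton_ssubset.2 he)
    have h2 := Set.ncard_sdiff_singleton_add_one he hY
    have h3 := Set.ncard_le_ncard (hmono (Y \ {e}) Set.sdiff_subset) hVfin
    omega
  · rintro x ⟨e, he, y, hy⟩
    exact ⟨e, y, he, hy⟩
  · rintro x ⟨e, he, y, hy⟩ hdeg
    have hsub : ∀ f, (edgeInduced G Y).Inc f x → f ∈ hY.toFinset := by
      rintro f ⟨z, hf, -⟩
      simpa using hf
    rw [degree_eq_sum _ x hsub] at hdeg
    have hpos : ∀ f, (edgeInduced G Y).Inc f x → 1 ≤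
        (if (edgeInduced G Y).IsNonloopAt f x then 1 else 0) +
          2 * (if (edgeInduced G Y).IsLoopAt f x then 1 else 0) := by
      rintro f ⟨z, hf⟩
      rw [mult_eq hf]
      simp
    have huniq : ∀ f, (edgeInduced G Y).Inc f x → f = e := by
      intro f hf
      by_contra hne
      have he' : (edgeInduced G Y).Inc e x := ⟨y, he, hy⟩
      have := Finset.sum_le_sum_of_subset (f := fun f =>
        (if (edgeInduced G Y).IsNonloopAt f x then 1 else 0) +
          2 * (if (edgeInduced G Y).IsLoopAt f x then 1 else 0))
        (show ({f, e} : Finset β) ⊆ hY.toFinset by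
          intro g hg
          simp only [Finset.mem_insert, Finset.mem_singleton] at hg
          rcases hg with rfl | rfl
          · exact hsub _ hf
          · exact hsub _ he')
      rw [Finset.sum_pair hne, hdeg] at this
      have := hpos f hf
      have := hpos e he'
      omega
    have h1 := hmin (Y \ {e}) (Set.sdiff_singleton_ssubset.2 he)
    have h2 := Set.ncard_sdiff_singleton_add_one he hY
    have hx : x ∈ V(edgeInduced G Y) := ⟨e, he, y, hy⟩
    have h3 : V(edgeInduced G (Y \ {e})) ⊆ V(edgeInduced G Y) \ {x} := by
      rintro w ⟨f, hf, hfw⟩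
      refine ⟨⟨f, hf.1, hfw⟩, ?_⟩
      rintro rfl
      obtain ⟨z, hz⟩ := hfw
      exact hf.2 (huniq f ⟨z, hf.1, hz⟩)
    have h4 := Set.ncard_le_ncard h3 hVfin.sdiff
    have h5 := Set.ncard_sdiff_singleton_add_one hx hVfin
    omega
  · intro x hx hcyc
    have hKsub : componentVerts (edgeInduced G Y) x ⊆ V(edgeInduced G Y) := by
      intro y hy
      rcases Relation.ReflTransGen.cases_tail hy with rfl | ⟨z, -, hz⟩
      · exact hx
      · exact hz.right_mem
    have hKfin := hVfin.subset hKsub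
    set K := componentVerts (edgeInduced G Y) x with hK
    have hclosed : ∀ e a b, (edgeInduced G Y).IsLink e a b → a ∈ K → b ∈ K :=
      fun e a b h ha => Relation.ReflTransGen.tail ha ⟨e, h⟩
    set F : Set β := {e | ∃ a ∈ K, (edgeInduced G Y).Inc e a} with hFdef
    have hFY : F ⊆ Y := by
      rintro e ⟨a, -, z, hz, -⟩
      exact hz
    have hFfin := hY.subset hFY
    have hcount := sum_degree_eq (H := edgeInduced G Y) hFfin.toFinset hKfin.toFinset (by
      intro a ha e he
      simp only [Set.Finite.mem_toFinset] at ha ⊢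
      exact ⟨a, ha, he⟩)
    rw [Finset.sum_congr rfl (g := fun _ => 2) (fun a ha => hcyc a (by simpa using ha)),
      Finset.sum_congr (s₁ := hFfin.toFinset) rfl (g := fun _ => 2) (by
        intro e he
        obtain ⟨a, ha, b, hab⟩ : e ∈ F := by simpa using he
        rw [sum_mult_eq _ hab]
        simp [ha, hclosed e a b hab ha])] at hcount
    simp only [Finset.sum_const, smul_eq_mul, ← Set.ncard_eq_toFinset_card] at hcount
    obtain ⟨e, he, hex⟩ := hx
    have heF : e ∈ F := by
      obtain ⟨z, hz⟩ := hex
      exact ⟨x, Relation.ReflTransGen.refl, z, he, hz⟩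
    have h1 := hmin (Y \ F) ⟨Set.sdiff_subset, fun hh => (hh he).2 heF⟩
    have h2 := Set.ncard_sdiff_add_ncard_of_subset hFY hY
    have h3 : V(edgeInduced G (Y \ F)) ⊆ V(edgeInduced G Y) \ K := by
      rintro w ⟨f, hf, hfw⟩
      refine ⟨⟨f, hf.1, hfw⟩, fun hw => hf.2 ?_⟩
      obtain ⟨z, hz⟩ := hfw
      exact ⟨w, hw, z, hf.1, hz⟩
    have h4 := Set.ncard_le_ncard h3 hVfin.sdiff
    have h5 := Set.ncard_sdiff_add_ncard_of_subset hKsub hVfin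
    omega

lemma kIndep_iff (hk : 1 ≤ k) (hG : E(G).Finite) : KIndep G k X ↔
    X ⊆ E(G) ∧ ∀ Y ⊆ X, Y.ncard < V(edgeInduced G Y).ncard + k := by
  refine and_congr_right fun hX => ⟨fun h Y hY => ?_, fun h C hC hCX => ?_⟩
  · by_contra hlt
    obtain ⟨C, hC, hCY⟩ := exists_kCircuit hk (hG.subset (hY.trans hX)) (hY.trans hX)
      (not_lt.1 hlt)
    exact h C hC (hCY.trans hY)
  · have h1 := h C hCX
    have h2 := (delta_eq_iff hC.1).1 hC.2.1
    omega

lemma kIndep_aug (hk : 1 ≤ k) (hG : E(G).Finite) {I J : Set β} (hI : KIndep G k I)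
    (hJ : KIndep G k J) (hIJ : I.ncard < J.ncard) : ∃ e ∈ J, e ∉ I ∧ KIndep G k (insert e I) := by
  by_contra! hcon
  have hIs := ((kIndep_iff hk hG).1 hI).2
  have hJs := ((kIndep_iff hk hG).1 hJ).2
  have hIfin := hG.subset hI.1
  have hJfin := hG.subset hJ.1
  have hVfin : ∀ {Y : Set β}, Y.Finite → V(edgeInduced G Y).Finite := fun hY => finite_ends hY
  have hmono : ∀ {Y Z : Set β}, Y ⊆ Z → V(edgeInduced G Y) ⊆ V(edgeInduced G Z) :=
    fun {_ _} hYZ x ⟨e, he, hx⟩ => ⟨e, hYZ he, hx⟩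
  -- tight subsets of `I`
  let Tight : Set (Set β) := {T | T ⊆ I ∧ T.ncard + 1 = V(edgeInduced G T).ncard + k}
  have hfinT : Tight.Finite := hIfin.finite_subsets.subset fun T hT => hT.1
  have hex : ∀ e ∈ J, e ∉ I → ∃ T ∈ Tight, ∀ x, G.Inc e x → x ∈ V(edgeInduced G T) := by
    intro e heJ heI
    have hdep := hcon e heJ heI
    rw [kIndep_iff hk hG] at hdep
    push Not at hdep
    obtain ⟨Y, hY, hYk⟩ := hdep (Set.insert_subset (hJ.1 heJ) hI.1)
    have hYfin : Y.Finite := (hIfin.insert e).subset hY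
    have heY : e ∈ Y := by
      by_contra he
      have := hIs Y ((Set.subset_insert_iff_of_notMem he).1 hY)
      omega
    have hsub : Y \ {e} ⊆ I := by
      intro f hf
      exact (hY hf.1).resolve_left hf.2
    have h1 := hIs _ hsub
    have h2 := Set.ncard_sdiff_singleton_add_one heY hYfin
    have h3 := Set.ncard_le_ncard (hmono (Set.sdiff_subset (s := Y) (t := {e})))
      (hVfin hYfin)
    have h4 : V(edgeInduced G (Y \ {e})) = V(edgeInduced G Y) :=
      Set.eq_of_subset_of_ncard_le (hmono Set.sdiff_subset) (by omega) (hVfin hYfin)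
    refine ⟨Y \ {e}, ⟨hsub, by omega⟩, fun x hx => ?_⟩
    rw [h4]
    exact ⟨e, heY, hx⟩
  have hunion : ∀ A ∈ Tight, ∀ B ∈ Tight, A ∪ B ∈ Tight := by
    rintro A ⟨hA, hA'⟩ B ⟨hB, hB'⟩
    have hAf := hIfin.subset hA
    have hBf := hIfin.subset hB
    refine ⟨Set.union_subset hA hB, ?_⟩
    have h1 := hIs _ (Set.union_subset hA hB)
    have h2 := hIs (A ∩ B) (Set.inter_subset_left.trans hA)
    have h3 := Set.ncard_union_add_ncard_inter A B hAf hBf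
    have h4 := Set.ncard_union_add_ncard_inter _ _ (hVfin hAf) (hVfin hBf)
    have h5 : V(edgeInduced G (A ∪ B)) = V(edgeInduced G A) ∪ V(edgeInduced G B) := by
      refine subset_antisymm ?_ (Set.union_subset (hmono Set.subset_union_left)
        (hmono Set.subset_union_right))
      rintro x ⟨e, he | he, hx⟩
      · exact Or.inl ⟨e, he, hx⟩
      · exact Or.inr ⟨e, he, hx⟩
    have h6 := Set.ncard_le_ncard (Set.subset_inter
      (hmono (Set.inter_subset_left (s := A) (t := B)))
      (hmono (Set.inter_subset_right (s := A) (t := B)))) ((hVfin hAf).inter_of_left _)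
    rw [h5] at h1 ⊢
    omega
  obtain ⟨e₀, he₀J, he₀I⟩ : ∃ e ∈ J, e ∉ I := by
    by_contra! h
    have := Set.ncard_le_ncard h hIfin
    omega
  obtain ⟨T₀, hT₀, -⟩ := hex e₀ he₀J he₀I
  obtain ⟨T, hT, hTmax⟩ := hfinT.exists_maximal ⟨T₀, hT₀⟩
  have hTf := hIfin.subset hT.1
  have hends : ∀ e ∈ J, e ∉ I → ∀ x, G.Inc e x → x ∈ V(edgeInduced G T) := by
    intro e heJ heI x hx
    obtain ⟨T', hT', h'⟩ := hex e heJ heI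
    exact hmono (Set.subset_union_right.trans (hTmax (hunion _ hT _ hT') Set.subset_union_left))
      (h' x hx)
  have hA := hJs (J \ (I \ T)) Set.sdiff_subset
  have hAV : V(edgeInduced G (J \ (I \ T))) ⊆ V(edgeInduced G T) := by
    rintro x ⟨e, ⟨heJ, he⟩, hx⟩
    by_cases heI : e ∈ I
    · exact ⟨e, by_contra fun h => he ⟨heI, h⟩, hx⟩
    · exact hends e heJ heI x hx
  have h1 := Set.ncard_le_ncard hAV (hVfin hTf)
  have h2 := Set.ncard_sdiff_add_ncard_of_subset hT.1 hIfin
  have h3 := Set.ncard_le_ncard_sdiff_add_ncard J (I \ T) hIfin.sdiff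
  have h4 := hT.2
  omega

lemma kIndep_empty (hk : 1 ≤ k) (hG : E(G).Finite) : KIndep G k ∅ := by
  rw [kIndep_iff hk hG]
  refine ⟨Set.empty_subset _, fun Y hY => ?_⟩
  rw [Set.subset_empty_iff.1 hY, Set.ncard_empty]
  omega

end aux

/-- The `k`-circular matroid `Mₖ(G)` of a finite graph `G`, for `k ≥ 1`: the matroid on the edge
set of `G` whose circuits are the `k`-circuits of `G` (see `isCircuit_iff`). -/
def circularMatroid {α β : Type*} (G : Graph α β) (hG : E(G).Finite) (k : ℕ) (hk : 1 ≤ k) :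
    Matroid β :=
  (IndepMatroid.ofFinite hG (KIndep G k) (kIndep_empty hk hG)
    (fun _ _ hJ hIJ => ⟨hIJ.trans hJ.1, fun C hC hCI => hJ.2 C hC (hCI.trans hIJ)⟩)
    (fun _ _ hI hJ hIJ => kIndep_aug hk hG hI hJ hIJ) (fun _ h => h.1)).matroid

theorem circularMatroid_ground {α β : Type*} (G : Graph α β) (hG : E(G).Finite) (k : ℕ)
    (hk : 1 ≤ k) : (circularMatroid G hG k hk).E = E(G) := rfl

theorem circularMatroid_indep {α β : Type*} (G : Graph α β) (hG : E(G).Finite) (k : ℕ)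
    (hk : 1 ≤ k) (X : Set β) : (circularMatroid G hG k hk).Indep X ↔ KIndep G k X := Iff.rfl

/-- A proper subset of a `k`-circuit has `Δ < k`. -/
lemma eq_of_subset_kCircuit {α β : Type*} {G : Graph α β} {k : ℕ} (hG : E(G).Finite)
    {C Y : Set β} (hC : C ∈ kCircuits G k) (hY : Y ⊆ C)
    (h : V(edgeInduced G Y).ncard + k ≤ Y.ncard) : Y = C := by
  classical
  obtain ⟨hCE, hCk, hcact⟩ := hC
  rw [delta_eq_iff hCE] at hCk
  have hCf := hG.subset hCE
  have hVf : V(edgeInduced G C).Finite := finite_ends hCf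
  have hVY : V(edgeInduced G Y) ⊆ V(edgeInduced G C) := fun x ⟨e, he, hx⟩ => ⟨e, hY he, hx⟩
  set W := V(edgeInduced G C) \ V(edgeInduced G Y) with hW
  have hWf : W.Finite := hVf.sdiff
  have hFf : (C \ Y).Finite := hCf.sdiff
  have h1 := Set.ncard_sdiff_add_ncard_of_subset hVY hVf
  rw [← hW] at h1
  have h2 := Set.ncard_sdiff_add_ncard_of_subset hY hCf
  have hinc : ∀ x ∈ W, ∀ e, (edgeInduced G C).Inc e x → e ∈ C \ Y := by
    rintro x hx e ⟨y, he, hy⟩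
    exact ⟨he, fun heY => hx.2 ⟨e, heY, y, hy⟩⟩
  have hcount := sum_degree_eq (H := edgeInduced G C) hFf.toFinset hWf.toFinset (by
    intro x hx e he
    simpa using hinc x (by simpa using hx) e he)
  have hdeg : ∀ x ∈ hWf.toFinset, 2 ≤ degree (edgeInduced G C) x := by
    intro x hx
    have hx' : x ∈ W := by simpa using hx
    have hn := hcact.no_leaf x hx'.1
    obtain ⟨e, y, hy⟩ := hcact.no_isolated x hx'.1
    have hsum := degree_eq_sum (H := edgeInduced G C) hFf.toFinset x
      (fun e he => by simpa using hinc x hx' e he)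
    have hle := Finset.single_le_sum (f := fun f =>
        (if (edgeInduced G C).IsNonloopAt f x then 1 else 0) +
          2 * (if (edgeInduced G C).IsLoopAt f x then 1 else 0))
        (fun _ _ => Nat.zero_le _)
        (show e ∈ hFf.toFinset by simpa using hinc x hx' e ⟨y, hy⟩)
    have : 1 ≤ (if (edgeInduced G C).IsNonloopAt e x then 1 else 0) +
          2 * (if (edgeInduced G C).IsLoopAt e x then 1 else 0) := by
      rw [mult_eq hy]
      simp
    omega
  have hle : ∀ e ∈ hFf.toFinset, ∑ x ∈ hWf.toFinset,
      ((if (edgeInduced G C).IsNonloopAt e x then 1 else 0) +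
        2 * (if (edgeInduced G C).IsLoopAt e x then 1 else 0)) ≤ 2 := by
    intro e he
    have he' : e ∈ C \ Y := by simpa using he
    obtain ⟨a, b, hab⟩ := exists_isLink_of_mem_edgeSet (hCE he'.1)
    rw [sum_mult_eq _ (show (edgeInduced G C).IsLink e a b from ⟨he'.1, hab⟩)]
    split_ifs <;> simp
  have hs1 := Finset.sum_le_sum hdeg
  have hs2 := Finset.sum_le_sum hle
  have hcW : hWf.toFinset.card = W.ncard := (Set.ncard_eq_toFinset_card W hWf).symm
  have hcF : hFf.toFinset.card = (C \ Y).ncard := (Set.ncard_eq_toFinset_card _ hFf).symm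
  simp only [Finset.sum_const, smul_eq_mul, hcW, hcF] at hs1 hs2
  rcases W.eq_empty_or_nonempty with hemp | ⟨w, hw⟩
  · have : (C \ Y).ncard = 0 := by
      rw [hemp, Set.ncard_empty] at h1
      omega
    rw [Set.ncard_eq_zero hFf, Set.sdiff_eq_empty] at this
    exact subset_antisymm hY this
  · exfalso
    have hdeg2 := (Finset.sum_eq_sum_iff_of_le hdeg).1 (by
      simp only [Finset.sum_const, smul_eq_mul, hcW]
      omega)
    have hle2 := (Finset.sum_eq_sum_iff_of_le hle).1 (by
      simp only [Finset.sum_const, smul_eq_mul, hcF]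
      omega)
    have hclosed : ∀ y ∈ componentVerts (edgeInduced G C) w, y ∈ W := by
      intro y hy
      induction hy with
      | refl => exact hw
      | tail _ hab ih =>
        obtain ⟨e, he⟩ := hab
        have hm := hinc _ ih e he.inc_left
        have h := hle2 e (by simpa using hm)
        rw [sum_mult_eq _ he] at h
        by_contra hb
        simp [hb] at h
        split_ifs at h; omega
    exact hcact.no_cycle_component w hw.1 fun y hy =>
      (hdeg2 y (by simpa using hclosed y hy)).symm

/-- The circuits of `Mₖ(G)` are exactly the `k`-circuits of `G`. -/
theorem isCircuit_iff {α β : Type*} (G : Graph α β) (hG : E(G).Finite) (k : ℕ) (hk : 1 ≤ k)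
    (C : Set β) : (circularMatroid G hG k hk).IsCircuit C ↔ C ∈ kCircuits G k := by
  constructor
  · intro h
    have hdep := h.not_indep
    rw [circularMatroid_indep, KIndep] at hdep
    push Not at hdep
    obtain ⟨D, hD, hDC⟩ := hdep h.subset_ground
    have hDdep : ¬ (circularMatroid G hG k hk).Indep D := fun hi => hi.2 D hD subset_rfl
    rcases hDC.eq_or_ssubset with rfl | hss
    · exact hD
    · exact absurd (h.ssubset_indep hss) hDdep
  · intro hC
    rw [Matroid.isCircuit_iff_minimal_not_indep (show C ⊆ _ from hC.1)]
    refine ⟨fun hi => hi.2 C hC subset_rfl, fun Y hY hYC => ?_⟩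
    change ¬ KIndep G k Y at hY
    rw [kIndep_iff hk hG] at hY
    push Not at hY
    obtain ⟨Z, hZ, hZk⟩ := hY (hYC.trans hC.1)
    have := eq_of_subset_kCircuit hG hC (hZ.trans hYC) hZk
    exact this ▸ hZ

/-- A matroid is connected if it has no loops and no coloops and every two elements belong to a
common circuit. -/
structure IsConnected {β : Type*} (M : Matroid β) : Prop where
  no_loop : ∀ e, ¬ M.IsLoop e
  no_coloop : ∀ e, ¬ M.IsColoop e
  common_circuit : ∀ e ∈ M.E, ∀ f ∈ M.E, ∃ C, M.IsCircuit C ∧ e ∈ C ∧ f ∈ C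

/-- A non-separating cocircuit of a connected matroid `M`. -/
def IsNonSeparatingCocircuit {β : Type*} (M : Matroid β) (K : Set β) : Prop :=
  M.IsCocircuit K ∧ IsConnected (M.delete K)

/-- The set `𝒮(G)` of vertex stars of `G`; the star of `v` is the set of edges incident to `v`. -/
def vertexStars {α β : Type*} (G : Graph α β) : Set (Set β) :=
  {S | ∃ v ∈ V(G), S = G.incidenceSet v}

/-- Strong isomorphism: the two graphs have the same edge set, and a bijection between their vertex
sets carries the ends of each edge in `G` to the ends of the same edge in `G'`. -/
def StronglyIsomorphic {α α' β : Type*} (G : Graph α β) (G' : Graph α' β) : Prop :=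
  E(G) = E(G') ∧ ∃ ν : V(G) ≃ V(G'), ∀ (e : β) (x y : V(G)),
    G.IsLink e x y ↔ G'.IsLink e (ν x) (ν y)

/-- No isolated vertices. -/
def NoIsolated {α β : Type*} (G : Graph α β) : Prop :=
  ∀ x ∈ V(G), (G.incidenceSet x).Nonempty

end KCircular

/-! A set of edges is independent in $M_k(G)$ exactly when every subset $Y$ of it satisfies $|Y| <
|V(G\langle Y\rangle)| + k$ (`kIndep_iff`). Tight sets, where $|Y|$ is one below this bound, are
closed under union inside an independent set. So a base of a coloop-free deletion is itself tight
and covers all remaining vertices, which makes the rank the number of those vertices plus $k-1$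
(`ncard_isBase_delete`).

Deleting a cocircuit $K$ with $M_k(G)\setminus K$ connected lowers the rank by one, hence loses
exactly one vertex $x$. The star of $x$ lies in $K$, and sparsity leaves no room for a further edge,
so $K$ is that star (`IsNonSeparatingCocircuit.existsUnique_eq_incidenceSet`).

Being a non-separating cocircuit depends only on the matroid, so every star of $G$ except that of
$v$ is also a star of $G'$. Equal ranks give equally many vertices, and in a loopless graph each
edge lies in exactly two stars, so the last star is forced. -/

namespace KCircular

/-! ### Rank and non-separating cocircuits -/

section Rank

variable {α β : Type*} {G : Graph α β} {k : ℕ} {X Y K B : Set β}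

lemma vertexSet_edgeInduced_mono (h : X ⊆ Y) : V(edgeInduced G X) ⊆ V(edgeInduced G Y) :=
  fun _ ⟨e, he, hx⟩ => ⟨e, h he, hx⟩

lemma vertexSet_edgeInduced_union :
    V(edgeInduced G (X ∪ Y)) = V(edgeInduced G X) ∪ V(edgeInduced G Y) := by
  refine subset_antisymm ?_ (Set.union_subset (vertexSet_edgeInduced_mono Set.subset_union_left)
    (vertexSet_edgeInduced_mono Set.subset_union_right))
  rintro x ⟨e, he | he, hx⟩
  · exact Or.inl ⟨e, he, hx⟩
  · exact Or.inr ⟨e, he, hx⟩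

lemma vertexSet_edgeInduced_edgeSet (hG : NoIsolated G) : V(edgeInduced G E(G)) = V(G) := by
  ext x
  refine ⟨fun ⟨e, _, hx⟩ => hx.vertex_mem, fun hx => ?_⟩
  obtain ⟨e, he⟩ := hG x hx
  exact ⟨e, he.edge_mem, he⟩

/-- An independent set `X` is tight if `|X| = |V(G⟨X⟩)| + k - 1`. Tight subsets of an independent
set are closed under unions. -/
lemma KIndep.tight_union (hk : 1 ≤ k) (hG : E(G).Finite) (hB : KIndep G k B) (hX : X ⊆ B)
    (hY : Y ⊆ B) (hX' : X.ncard + 1 = V(edgeInduced G X).ncard + k)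
    (hY' : Y.ncard + 1 = V(edgeInduced G Y).ncard + k) :
    (X ∪ Y).ncard + 1 = V(edgeInduced G (X ∪ Y)).ncard + k := by
  have hBs := ((kIndep_iff hk hG).1 hB).2
  have hBf := hG.subset hB.1
  have hXf := hBf.subset hX
  have hYf := hBf.subset hY
  -- Edge counts are modular and vertex counts submodular, so the sparsity bound on $X\cap Y$ forces
  -- equality in the one on $X\cup Y$. An empty intersection is harmless because $k\ge 1$.
  have h1 := hBs _ (Set.union_subset hX hY)
  have h2 := hBs (X ∩ Y) (Set.inter_subset_left.trans hX)
  have h3 := Set.ncard_union_add_ncard_inter X Y hXf hYf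
  have h4 := Set.ncard_union_add_ncard_inter V(edgeInduced G X) V(edgeInduced G Y)
    (finite_ends hXf) (finite_ends hYf)
  have h5 := Set.ncard_le_ncard (Set.subset_inter
    (vertexSet_edgeInduced_mono (G := G) (Set.inter_subset_left (s := X) (t := Y)))
    (vertexSet_edgeInduced_mono (Set.inter_subset_right (s := X) (t := Y))))
    ((finite_ends hXf).inter_of_left _)
  rw [vertexSet_edgeInduced_union] at h1 ⊢
  omega

/-- An edge that cannot be added to an independent set `B` has its ends in a tight subset of
`B`. -/
lemma KIndep.exists_tight (hk : 1 ≤ k) (hG : E(G).Finite) (hB : KIndep G k B) {e : β}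
    (he : e ∈ E(G)) (hdep : ¬ KIndep G k (insert e B)) :
    ∃ T ⊆ B, T.ncard + 1 = V(edgeInduced G T).ncard + k ∧
      ∀ x, G.Inc e x → x ∈ V(edgeInduced G T) := by
  have hBs := ((kIndep_iff hk hG).1 hB).2
  rw [kIndep_iff hk hG] at hdep
  push Not at hdep
  obtain ⟨Y, hY, hYk⟩ := hdep (Set.insert_subset he hB.1)
  have hYf : Y.Finite := ((hG.subset hB.1).insert e).subset hY
  have heY : e ∈ Y := by
    by_contra h
    have := hBs Y ((Set.subset_insert_iff_of_notMem h).1 hY)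
    omega
  have hsub : Y \ {e} ⊆ B := fun f hf => (hY hf.1).resolve_left hf.2
  -- $Y$ violates the bound and $Y\setminus\{e\}$ obeys it; losing one edge bridges the gap only if
  -- no vertex is lost and $Y\setminus\{e\}$ is tight.
  have h1 := hBs _ hsub
  have h2 := Set.ncard_sdiff_singleton_add_one heY hYf
  have hmono := vertexSet_edgeInduced_mono (G := G) (Set.sdiff_subset (s := Y) (t := {e}))
  have hVf : V(edgeInduced G Y).Finite := finite_ends hYf
  have h3 := Set.ncard_le_ncard hmono hVf
  have h4 := Set.eq_of_subset_of_ncard_le hmono (by omega) hVf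
  refine ⟨Y \ {e}, hsub, by omega, fun x hx => ?_⟩
  rw [h4]
  exact ⟨e, heY, hx⟩

/-- If `Mₖ(G) \ K` is nonempty and has no coloops then its rank is
`|V(G⟨E(G) \ K⟩)| + k - 1`. -/
lemma ncard_isBase_delete (hk : 1 ≤ k) (hG : E(G).Finite) (hne : (E(G) \ K).Nonempty)
    (hco : ∀ e, ¬ ((circularMatroid G hG k hk).delete K).IsColoop e)
    (hB : ((circularMatroid G hG k hk).delete K).IsBase B) :
    B.ncard + 1 = V(edgeInduced G (E(G) \ K)).ncard + k := by
  set M := circularMatroid G hG k hk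
  have hBH : B ⊆ E(G) \ K := hB.subset_ground
  have hBI : KIndep G k B := hB.indep.of_delete
  have hBf : B.Finite := hG.subset hBI.1
  let Tight : Set (Set β) := {T | T ⊆ B ∧ T.ncard + 1 = V(edgeInduced G T).ncard + k}
  have hex : ∀ e ∈ E(G) \ K, e ∉ B → ∃ T ∈ Tight, ∀ x, G.Inc e x → x ∈ V(edgeInduced G T) := by
    intro e he heB
    have hdep : ¬ KIndep G k (insert e B) := fun hI => heB <| by
      have hi : (M.delete K).Indep (insert e B) := Matroid.delete_indep_iff.2
        ⟨hI, Set.disjoint_left.2 fun f hf hfK =>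
          hf.elim (fun h => he.2 (h ▸ hfK)) fun h => (hBH h).2 hfK⟩
      rw [hB.eq_of_subset_indep hi (Set.subset_insert e B)]
      exact Set.mem_insert e B
    obtain ⟨T, hT, h1, h2⟩ := hBI.exists_tight hk hG he.1 hdep
    exact ⟨T, ⟨hT, h1⟩, h2⟩
  have hbase : ∀ e, ∃ B', (M.delete K).IsBase B' ∧ e ∉ B' := fun e => by
    simpa [Matroid.isColoop_iff_forall_mem_isBase] using hco e
  -- Without coloops no base is the whole ground set, so a tight set exists.
  obtain ⟨e₀, he₀, he₀B⟩ : ∃ e ∈ E(G) \ K, e ∉ B := by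
    obtain ⟨f, hf⟩ := hne
    by_cases hfB : f ∈ B
    · obtain ⟨B', hB', hfB'⟩ := hbase f
      obtain ⟨e, he, -⟩ := hB.exchange hB' ⟨hfB, hfB'⟩
      exact ⟨e, hB'.subset_ground he.1, he.2⟩
    · exact ⟨f, hf, hfB⟩
  obtain ⟨T₀, hT₀, -⟩ := hex e₀ he₀ he₀B
  have hTfin : Tight.Finite := hBf.finite_subsets.subset fun T hT => hT.1
  obtain ⟨T, ⟨hTB, hT⟩, hTmax⟩ := hTfin.exists_maximal ⟨T₀, hT₀⟩
  -- By closure under unions, a maximal tight set contains every tight subset of $B$.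
  have hends : ∀ e ∈ E(G) \ K, e ∉ B → ∀ x, G.Inc e x → x ∈ V(edgeInduced G T) := by
    intro e he heB x hx
    obtain ⟨T', hT', h'⟩ := hex e he heB
    refine vertexSet_edgeInduced_mono (Set.subset_union_right.trans (hTmax
      ⟨Set.union_subset hTB hT'.1, hBI.tight_union hk hG hTB hT'.1 hT hT'.2⟩
      Set.subset_union_left)) (h' x hx)
  -- an edge of `B \ T` would be a coloop
  have hTeq : T = B := by
    refine subset_antisymm hTB fun f hfB => by_contra fun hfT => ?_
    obtain ⟨B', hB', hfB'⟩ := hbase f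
    have hB'I : KIndep G k B' := hB'.indep.of_delete
    -- Outside $B\setminus T$ the base $B'$ lives on the vertices of $T$, so it has at most $|T|$
    -- edges there; as it also misses $f\in B\setminus T$, it would be smaller than $B$.
    have hA := ((kIndep_iff hk hG).1 hB'I).2 (B' \ (B \ T)) Set.sdiff_subset
    have hAV : V(edgeInduced G (B' \ (B \ T))) ⊆ V(edgeInduced G T) := by
      rintro x ⟨e, ⟨heB', he⟩, hx⟩
      by_cases heB : e ∈ B
      · exact ⟨e, by_contra fun h => he ⟨heB, h⟩, hx⟩
      · exact hends e (hB'.subset_ground heB') heB x hx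
    have h1 := Set.ncard_le_ncard hAV (finite_ends (hBf.subset hTB))
    have h2 := Set.ncard_sdiff_add_ncard_of_subset hTB hBf
    have h3 := Set.ncard_inter_add_ncard_sdiff_eq_ncard B' (B \ T) (hG.subset hB'I.1)
    have h4 : (B' ∩ (B \ T)).ncard < (B \ T).ncard :=
      Set.ncard_lt_ncard ⟨Set.inter_subset_right, fun h => hfB' (h ⟨hfB, hfT⟩).1⟩ hBf.sdiff
    have h5 := hB.ncard_eq_ncard_of_isBase hB'
    omega
  subst hTeq
  have : V(edgeInduced G (E(G) \ K)) = V(edgeInduced G T) := by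
    refine subset_antisymm ?_ (vertexSet_edgeInduced_mono hBH)
    rintro x ⟨e, he, hx⟩
    by_cases heT : e ∈ T
    · exact ⟨e, heT, hx⟩
    · exact hends e he heT x hx
  rw [this, hT]

/-- A connected `Mₖ(G)` has rank `|V(G)| + k - 1`. -/
lemma ncard_isBase (hk : 1 ≤ k) (hG : E(G).Finite) (hiso : NoIsolated G) (hne : E(G).Nonempty)
    (hconn : IsConnected (circularMatroid G hG k hk)) (hB : (circularMatroid G hG k hk).IsBase B) :
    B.ncard + 1 = V(G).ncard + k := by
  rw [← vertexSet_edgeInduced_edgeSet hiso, ← Set.sdiff_empty (s := E(G))]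
  refine ncard_isBase_delete hk hG (by simpa using hne) ?_ (by simpa using hB)
  simpa using hconn.no_coloop

/-- A non-separating cocircuit of `Mₖ(G)` is the star of exactly one vertex. -/
lemma IsNonSeparatingCocircuit.existsUnique_eq_incidenceSet (hk : 1 ≤ k) (hV : V(G).Finite)
    (hG : E(G).Finite) (hiso : NoIsolated G) (hloop : G.Loopless)
    (hconn : IsConnected (circularMatroid G hG k hk))
    (hK : IsNonSeparatingCocircuit (circularMatroid G hG k hk) K) :
    ∃! x, x ∈ V(G) ∧ G.incidenceSet x = K := by
  obtain ⟨hKc, hKd⟩ := hK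
  set M := circularMatroid G hG k hk with hMdef
  have hKE : K ⊆ E(G) := hKc.subset_ground
  have hEne : E(G).Nonempty := hKc.nonempty.mono hKE
  -- Two vertices make the rank at least $2$, which ensures below that $E(G)\setminus K$ is
  -- nonempty.
  have hV2 : 2 ≤ V(G).ncard := by
    obtain ⟨e, he⟩ := hEne
    obtain ⟨a, b, hab⟩ := exists_isLink_of_mem_edgeSet he
    exact (Set.one_lt_ncard_iff hV).2 ⟨a, b, hab.left_mem, hab.right_mem, hab.ne⟩
  have hmin := Matroid.isCocircuit_iff_minimal.1 hKc
  -- A cocircuit is a minimal set meeting every base, so some base meets $K$ only in $e$.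
  have hbase : ∀ e ∈ K, ∃ B, M.IsBase B ∧ e ∈ B ∧ B \ {e} ⊆ E(G) \ K := by
    intro e he
    have h := hmin.not_prop_of_ssubset (Set.sdiff_singleton_ssubset.2 he)
    push Not at h
    obtain ⟨B, hB, hBe⟩ := h
    have hsub : ∀ f ∈ B, f ∈ K → f = e := fun f hf hfK => by_contra fun hfe =>
      Set.notMem_empty f (hBe ▸ ⟨⟨hfK, hfe⟩, hf⟩)
    obtain ⟨f, hfK, hfB⟩ := hmin.prop B hB
    refine ⟨B, hB, hsub f hfB hfK ▸ hfB, fun g hg => ⟨hB.subset_ground hg.1, fun hgK =>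
      hg.2 (hsub g hg.1 hgK)⟩⟩
  obtain ⟨e, heK⟩ := hKc.nonempty
  obtain ⟨B, hB, heB, hBK⟩ := hbase e heK
  have hBf : B.Finite := hG.subset hB.subset_ground
  have hBcard := ncard_isBase hk hG hiso hEne hconn hB
  have hBe := Set.ncard_sdiff_singleton_add_one heB hBf
  have hHne : (E(G) \ K).Nonempty := by
    rw [Set.nonempty_iff_ne_empty]
    intro h
    rw [h, Set.subset_empty_iff] at hBK
    rw [hBK, Set.ncard_empty] at hBe
    omega
  -- The deletion has rank exactly one less: at least $|B|-1$ because of $B\setminus\{e\}$, and less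
  -- than $|B|$ because every base of $M$ meets $K$. The two rank formulas turn this into a vertex
  -- count.
  have hVH : V(edgeInduced G (E(G) \ K)).ncard + 1 = V(G).ncard := by
    have hi : (M.delete K).Indep (B \ {e}) := Matroid.delete_indep_iff.2
      ⟨hB.indep.subset Set.sdiff_subset, Set.disjoint_left.2 fun f hf => (hBK hf).2⟩
    obtain ⟨D, hD, hBD⟩ := hi.exists_isBase_superset
    have hDcard := ncard_isBase_delete hk hG hHne hKd.no_coloop hD
    obtain ⟨D', hD', hDD'⟩ := hD.indep.of_delete.exists_isBase_superset
    have hDf : D'.Finite := hG.subset hD'.subset_ground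
    have hss : D ⊂ D' := by
      refine ⟨hDD', fun h => ?_⟩
      obtain ⟨f, hfK, hf⟩ := hmin.prop D' hD'
      exact (hD.subset_ground (h hf)).2 hfK
    have h1 := Set.ncard_lt_ncard hss hDf
    have h2 := Set.ncard_le_ncard hBD (hDf.subset hDD')
    have h3 := ncard_isBase hk hG hiso hEne hconn hD'
    omega
  have hVHsub : V(edgeInduced G (E(G) \ K)) ⊆ V(G) := fun x ⟨_, _, hx⟩ => hx.vertex_mem
  have hdiff := Set.ncard_sdiff_add_ncard_of_subset hVHsub hV
  obtain ⟨x, hx⟩ := Set.ncard_eq_one.1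
    (show (V(G) \ V(edgeInduced G (E(G) \ K))).ncard = 1 by omega)
  have hx' : x ∈ V(G) \ V(edgeInduced G (E(G) \ K)) := hx ▸ rfl
  refine ⟨x, ⟨hx'.1, subset_antisymm (fun f hf => ?_) fun f hfK => by_contra fun hfx => ?_⟩, ?_⟩
  · exact by_contra fun hfK => hx'.2 ⟨f, ⟨hf.edge_mem, hfK⟩, hf⟩
  -- If $f$ avoids $x$, the base $D$ has $|V(G)|+k-1$ edges on at most $|V(G)|-1$ vertices,
  -- contradicting sparsity.
  · obtain ⟨D, hD, hfD, hDK⟩ := hbase f hfK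
    have hDcard := ncard_isBase hk hG hiso hEne hconn hD
    have hDV : V(edgeInduced G D) ⊆ V(edgeInduced G (E(G) \ K)) := by
      rintro y ⟨g, hg, hgy⟩
      by_cases hgf : g = f
      · by_contra hy
        have hyx : y ∈ ({x} : Set α) := hx ▸ ⟨hgy.vertex_mem, hy⟩
        rw [Set.mem_singleton_iff] at hyx
        subst hyx hgf
        exact hfx hgy
      · exact ⟨g, hDK ⟨hg, hgf⟩, hgy⟩
    have h1 := Set.ncard_le_ncard hDV (hV.subset hVHsub)
    have h2 := ((kIndep_iff hk hG).1 (show KIndep G k D from hD.indep)).2 D subset_rfl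
    omega
  · rintro y ⟨hy, rfl⟩
    have : y ∈ ({x} : Set α) := hx ▸ ⟨hy, fun ⟨f, hf, hfy⟩ => hf.2 hfy⟩
    exact this

end Rank

/-! ### Reconstructing a loopless graph from its stars -/

section Stars

variable {α α' β : Type*} {G : Graph α β} {G' : Graph α' β}

lemma isLink_iff_inc_inc_ne (hloop : G.Loopless) {e : β} {x y : α} :
    G.IsLink e x y ↔ G.Inc e x ∧ G.Inc e y ∧ x ≠ y := by
  refine ⟨fun h => ⟨h.inc_left, h.inc_right, h.ne⟩, fun ⟨⟨z, hz⟩, hy, hne⟩ => ?_⟩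
  rwa [hy.eq_of_isLink_of_ne_left hz hne.symm]

/-- Otherwise both ends of $e$ in $G'$ come from vertices other than $v$; these are distinct and
their stars agree, so $e$ would have three ends in $G$. -/
lemma inc_of_bijOn_of_forall_ne (hE : E(G) = E(G')) (hloop' : G'.Loopless) {f : α → α'} {v : α}
    (hf : Set.BijOn f V(G) V(G'))
    (hstar : ∀ u ∈ V(G), u ≠ v → G'.incidenceSet (f u) = G.incidenceSet u) {e : β}
    (he : G.Inc e v) : G'.Inc e (f v) := by
  obtain ⟨p, q, hpq⟩ := exists_isLink_of_mem_edgeSet (hE ▸ he.edge_mem)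
  obtain ⟨a, ha, rfl⟩ := hf.surjOn hpq.left_mem
  obtain ⟨c, hc, rfl⟩ := hf.surjOn hpq.right_mem
  by_cases hav : a = v
  · exact hav ▸ hpq.inc_left
  by_cases hcv : c = v
  · exact hcv ▸ hpq.inc_right
  have hac : a ≠ c := fun h => hpq.ne (congrArg f h)
  have hea : e ∈ G.incidenceSet a := hstar a ha hav ▸ hpq.inc_left
  have hec : e ∈ G.incidenceSet c := hstar c hc hcv ▸ hpq.inc_right
  rcases Inc.eq_or_eq_or_eq he hea hec with h | h | h
  · exact absurd h.symm hav
  · exact absurd h.symm hcv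
  · exact absurd h hac

/-- The stars of all but one vertex of a loopless graph determine the remaining star. -/
lemma incidenceSet_eq_of_bijOn_of_forall_ne (hE : E(G) = E(G')) (hloop : G.Loopless)
    (hloop' : G'.Loopless) {f : α → α'} {v : α} (hv : v ∈ V(G)) (hf : Set.BijOn f V(G) V(G'))
    (hstar : ∀ u ∈ V(G), u ≠ v → G'.incidenceSet (f u) = G.incidenceSet u) :
    G'.incidenceSet (f v) = G.incidenceSet v := by
  have : Nonempty α := ⟨v⟩
  refine subset_antisymm (fun e he => ?_) fun e he =>
    inc_of_bijOn_of_forall_ne hE hloop' hf hstar he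
  -- The reverse inclusion is the same argument for the inverse bijection.
  have hinv := hf.invOn_invFunOn
  have hg := hinv.symm.bijOn (hf.surjOn.mapsTo_invFunOn) hf.mapsTo
  have hgv := hinv.1 hv
  rw [← hgv]
  refine inc_of_bijOn_of_forall_ne hE.symm hloop hg (fun u hu huv => ?_) he
  have hfu := hinv.2 hu
  rw [← hstar _ (hg.mapsTo hu) fun h => huv (by rw [← hfu, h]), hfu]

/-- A bijection between the vertices of loopless graphs that preserves stars is a strong
isomorphism. -/
lemma StronglyIsomorphic.of_bijOn (hE : E(G) = E(G')) (hloop : G.Loopless) (hloop' : G'.Loopless)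
    {f : α → α'} (hf : Set.BijOn f V(G) V(G'))
    (hstar : ∀ u ∈ V(G), G'.incidenceSet (f u) = G.incidenceSet u) : StronglyIsomorphic G G' := by
  refine ⟨hE, hf.equiv f, fun e x y => ?_⟩
  have hinc : ∀ u : V(G), G'.Inc e (f u) ↔ G.Inc e u := fun u =>
    Set.ext_iff.1 (hstar u u.2) e
  change _ ↔ G'.IsLink e (f x) (f y)
  rw [isLink_iff_inc_inc_ne hloop, isLink_iff_inc_inc_ne hloop', hinc, hinc,
    hf.injOn.ne_iff x.2 y.2]

lemma vertexStars_eq_of_bijOn {f : α → α'} (hf : Set.BijOn f V(G) V(G'))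
    (hstar : ∀ u ∈ V(G), G'.incidenceSet (f u) = G.incidenceSet u) :
    vertexStars G = vertexStars G' := by
  ext S
  constructor
  · rintro ⟨u, hu, rfl⟩
    exact ⟨f u, hf.mapsTo hu, (hstar u hu).symm⟩
  · rintro ⟨w, hw, rfl⟩
    obtain ⟨u, hu, rfl⟩ := hf.surjOn hw
    exact ⟨u, hu, hstar u hu⟩

/-- An injection defined on all but one element of a finite set, into a set of the same size,
extends to a bijection. -/
lemma exists_bijOn_of_injOn_sdiff_singleton {s : Set α} {t : Set α'} {v : α} {f : α → α'}
    (hs : s.Finite) (ht : t.Finite) (hv : v ∈ s) (hcard : s.ncard = t.ncard)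
    (hmaps : Set.MapsTo f (s \ {v}) t) (hinj : Set.InjOn f (s \ {v})) :
    ∃ g : α → α', Set.BijOn g s t ∧ ∀ u, u ≠ v → g u = f u := by
  classical
  have h1 := Set.ncard_sdiff_singleton_add_one hv hs
  have h2 := Set.InjOn.ncard_image hinj
  obtain ⟨w, hw, hwf⟩ : ∃ w ∈ t, w ∉ f '' (s \ {v}) :=
    Set.exists_mem_notMem_of_ncard_lt_ncard (by omega) (hs.sdiff.image f)
  have hmaps' : Set.MapsTo (Function.update f v w) s t := fun u hu => by
    by_cases huv : u = v
    · simpa [huv] using hw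
    · simpa [huv] using hmaps ⟨hu, huv⟩
  have hinj' : Set.InjOn (Function.update f v w) s := fun a ha b hb hab => by
    by_cases hav : a = v <;> by_cases hbv : b = v
    · rw [hav, hbv]
    · rw [hav, Function.update_self, Function.update_of_ne hbv] at hab
      exact absurd ⟨b, ⟨hb, hbv⟩, hab.symm⟩ hwf
    · rw [hbv, Function.update_self, Function.update_of_ne hav] at hab
      exact absurd ⟨a, ⟨ha, hav⟩, hab⟩ hwf
    · rw [Function.update_of_ne hav, Function.update_of_ne hbv] at hab
      exact hinj ⟨ha, hav⟩ ⟨hb, hbv⟩ hab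
  refine ⟨Function.update f v w, ⟨hmaps', hinj', ?_⟩, fun u hu => Function.update_of_ne hu _ _⟩
  refine (Set.eq_of_subset_of_ncard_le hmaps'.image_subset ?_ ht).superset
  rw [Set.InjOn.ncard_image hinj', hcard]

end Stars

end KCircular

/-! ### The main theorem -/

theorem mainTheorem10 {α α' β : Type*} (G : Graph α β) (G' : Graph α' β) (k : ℕ) (hk : 1 ≤ k)
    (hV : V(G).Finite) (hE : E(G).Finite) (hV' : V(G').Finite) (hE' : E(G').Finite)
    (hiso : KCircular.NoIsolated G) (hiso' : KCircular.NoIsolated G')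
    (hloop : G.Loopless) (hloop' : G'.Loopless)
    (hconn : KCircular.IsConnected (KCircular.circularMatroid G hE k hk))
    (hstar : ∃! v, v ∈ V(G) ∧ ¬ KCircular.IsNonSeparatingCocircuit
      (KCircular.circularMatroid G hE k hk) (G.incidenceSet v))
    (hM : KCircular.circularMatroid G' hE' k hk = KCircular.circularMatroid G hE k hk) :
    KCircular.vertexStars G = KCircular.vertexStars G' ∧ KCircular.StronglyIsomorphic G G' := by
  obtain ⟨v, ⟨hv, -⟩, huniq⟩ := hstar
  have hEE : E(G) = E(G') := congrArg Matroid.E hM.symm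
  have hne : E(G).Nonempty := let ⟨e, he⟩ := hiso v hv; ⟨e, he.edge_mem⟩
  have hconn' : KCircular.IsConnected (KCircular.circularMatroid G' hE' k hk) := hM ▸ hconn
  have hns : ∀ u ∈ V(G) \ {v}, KCircular.IsNonSeparatingCocircuit
      (KCircular.circularMatroid G hE k hk) (G.incidenceSet u) := fun u hu =>
    by_contra fun h => hu.2 (huniq u ⟨hu.1, h⟩)
  -- A common base computes both vertex numbers.
  have hcard : V(G).ncard = V(G').ncard := by
    obtain ⟨B, hB⟩ := (KCircular.circularMatroid G hE k hk).exists_isBase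
    have h1 := KCircular.ncard_isBase hk hE hiso hne hconn hB
    have h2 := KCircular.ncard_isBase hk hE' hiso' (hEE ▸ hne) hconn' (hM ▸ hB)
    omega
  have hex : ∀ u, ∃ w, u ∈ V(G) \ {v} → w ∈ V(G') ∧ G'.incidenceSet w = G.incidenceSet u := by
    intro u
    by_cases hu : u ∈ V(G) \ {v}
    · obtain ⟨w, hw, -⟩ := KCircular.IsNonSeparatingCocircuit.existsUnique_eq_incidenceSet hk hV'
        hE' hiso' hloop' hconn' (hM ▸ hns u hu)
      exact ⟨w, fun _ => hw⟩
    -- Off $V(G)\setminus\{v\}$ the value is arbitrary; it only makes $f$ total.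
    · have hne' : V(G').Nonempty := by
        rw [← Set.ncard_pos hV', ← hcard, Set.ncard_pos hV]
        exact ⟨v, hv⟩
      exact ⟨hne'.some, fun h => absurd h hu⟩
  choose f hf using hex
  -- Equal images mean equal stars in $G$, and a non-separating cocircuit is the star of only one
  -- vertex.
  have hinj : Set.InjOn f (V(G) \ {v}) := fun a ha b hb hab => by
    obtain ⟨x, -, hx⟩ := KCircular.IsNonSeparatingCocircuit.existsUnique_eq_incidenceSet hk hV
      hE hiso hloop hconn (hns a ha)
    rw [hx a ⟨ha.1, rfl⟩, hx b ⟨hb.1, by rw [← (hf a ha).2, ← (hf b hb).2, hab]⟩]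
  obtain ⟨g, hg, hgf⟩ := KCircular.exists_bijOn_of_injOn_sdiff_singleton hV hV' hv hcard
    (fun u hu => (hf u hu).1) hinj
  have hstar' : ∀ u ∈ V(G), u ≠ v → G'.incidenceSet (g u) = G.incidenceSet u := fun u hu huv => by
    rw [hgf u huv, (hf u ⟨hu, huv⟩).2]
  have hall : ∀ u ∈ V(G), G'.incidenceSet (g u) = G.incidenceSet u := fun u hu => by
    by_cases huv : u = v
    · subst huv
      exact KCircular.incidenceSet_eq_of_bijOn_of_forall_ne hEE hloop hloop' hv hg hstar'
    · exact hstar' u hu huv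
  exact ⟨KCircular.vertexStars_eq_of_bijOn hg hall,
    KCircular.StronglyIsomorphic.of_bijOn hEE hloop hloop' hg hall⟩
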